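/- Throughout $\mathbb N=\{1,2,3,\dots\}$, $c_{00}$ is the space of finitely supported real sequences $x=(x_i)_{i\in\mathbb N}$ with unit vectors $(e_i)$, $\|\cdot\|_\infty$ is the sup norm, and for $E\subset\mathbb N$, $Ex$ is the restriction of $x$ to $E$. The Schreier families are $S_0=\{\{n\}:n\in\mathbb N\}\cup\{\emptyset\}$ and $S_{k+1}=\{\bigcup_{i=1}^n F_i: n\in\mathbb N,\ n\le F_1<\dots<F_n,\ F_i\in S_k\}$, where the $F_i$ may be empty, $F_i<F_j$ (meaning $a<b$ for all $a\in F_i$, $b\in F_j$) is required for all $i<j$, and $n\le a$ is required for all $a\in\bigcup_i F_i$. A finite family $(E_i)$ of nonempty finite subsets of $\mathbb N$ is $S_n$-admissible if $E_1<E_2<\cdots$ and $\{\min E_i\}\in S_n$; it is $S_n$-allowable if the $E_i$ are pairwise disjoint and $\{\min E_i\}\in S_n$. A weight sequence is a sequence $\alpha=(\alpha_n)_{n\in\mathbb N}\subset(0,1)$ with $\sum_n\alpha_n=1$ and $0<\inf_n\frac{\alpha_{n+1}}{\alpha_n}\le\sup_n\frac{\alpha_{n+1}}{\alpha_n}<1$.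 Let $(\theta_n)_{n\in\mathbb N}\subset(0,1)$ and $s\in\mathbb N$. For $x\in c_{00}$ put $\|x\|_{V,0}=\|x\|_{W,0}=\|x\|_\infty$ and, for $m\ge 0$, $$\|x\|_{V,m+1}=\|x\|_\infty\vee\sup_{n\ge1}\sup\Big\{\theta_n\sum_i\|E_ix\|_{V,m}:(E_i)\text{ is }S_n\text{-allowable}\Big\},$$ $$\|x\|_{W,m+1}=\|x\|_\infty\vee\sup_{1\le n\le s}\sup\Big\{\theta_n\sum_i\|E_ix\|_{W,m}:(E_i)\text{ is }S_n\text{-allowable}\Big\}\vee\sup_{n\ge s+1}\sup\Big\{\theta_n\sum_i\|E_ix\|_{W,m}:(E_i)\text{ is }S_n\text{-admissible}\Big\}.$$ For a weight sequence $\alpha$, let $V'$ and $W'$ be the completions of $c_{00}$ under the norms $\sum_{n\ge1}\alpha_n\|x\|_{V,n}$ and $\sum_{n\ge1}\alpha_n\|x\|_{W,n}$. For a space $X$ that is the completion of $c_{00}$ under a norm $\|\cdot\|$ for which $(e_i)$ is 1-unconditional, its 2-convexification $X^{(2)}$ is the completion of $c_{00}$ under the norm $\|x\|_{(2)}=\|(x_i^2)_i\|^{1/2}$.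 For a weight sequence $\beta$, Edgington's space $E_\beta$ is the completion of $c_{00}$ under $$\|x\|_{E_\beta}=\Big(\sum_{n\ge1}\beta_n\|x\|_{E,n}^2\Big)^{1/2},\quad\text{where }\|x\|_{E,0}=\|x\|_\infty,\ \ \|x\|_{E,n+1}^2=\sup\Big\{\sum_i\|E_ix\|_{E,n}^2:(E_i)\text{ is }S_1\text{-admissible}\Big\}.$$ **Theorem.** Let $(\theta_n)\subset(0,1)$ with $\lim_n\theta_n=0$ and $\lim_n\theta_n^{1/n}=1$, let $s\in\mathbb N$, and let $\alpha$ and $\beta$ be weight sequences. Form $V'$ and $W'$ from $(\theta_n)$, $s$ and $\alpha$. Then neither ${V'}^{(2)}$ nor ${W'}^{(2)}$ is isomorphic (linearly homeomorphic) to $E_\beta$. -/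

import Mathlib

open Filter Topology

noncomputable section

namespace WeakHilbert

/-- `c₀₀`: finitely supported real sequences, indexed by `ℕ = {1, 2, 3, …}`. -/
abbrev C00 : Type := ℕ+ →₀ ℝ

/-- The restriction `E x` of `x` to the finite set `E`. -/
def restr (E : Finset ℕ+) (x : C00) : C00 := x.filter (fun i => i ∈ E)

/-- The coordinatewise square `x ^ 2`. -/
def sq (x : C00) : C00 := x.mapRange (fun t => t ^ 2) (by simp)

/-- The sup norm. -/
def supNorm (x : C00) : ℝ := ⨆ i, |x i|

/-! ### Schreier families, admissible and allowable families -/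

/-- `F < G` for finite sets of positive integers (vacuous if one of them is empty). -/
def Before (F G : Finset ℕ+) : Prop := ∀ a ∈ F, ∀ b ∈ G, a < b

/-- The Schreier families: `S_0` consists of the singletons and `∅`, and `S_{k+1}` of the unions
`G_1 ∪ ⋯ ∪ G_n` with `n ≥ 1`, `n ≤ G_1 < ⋯ < G_n` and `G_i ∈ S_k`. Some `G_i` may be empty, so the
chain of inequalities is written out for all the `G_i` and for all the pairs `i < j`. -/
def schreier : ℕ → Set (Finset ℕ+)
  | 0 => {F | F = ∅ ∨ ∃ n, F = {n}}
  | k + 1 => {F | ∃ (n : ℕ+) (G : Fin n → Finset ℕ+),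
      (∀ i, G i ∈ schreier k) ∧ (∀ i, ∀ a ∈ G i, n ≤ a) ∧
      (∀ i j, i < j → Before (G i) (G j)) ∧ F = Finset.univ.biUnion G}

/-- The family `E_1, …, E_k` of nonempty finite sets is `S_n`-admissible:
`E_1 < E_2 < ⋯` and `{min E_i} ∈ S_n`. -/
def IsAdmissible (n : ℕ) {k : ℕ} (E : Fin k → Finset ℕ+) : Prop :=
  (∀ i j, i < j → Before (E i) (E j)) ∧
  ∃ h : ∀ i, (E i).Nonempty, Finset.univ.image (fun i => (E i).min' (h i)) ∈ schreier n

/-- The family `E_1, …, E_k` of nonempty finite sets is `S_n`-allowable: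
the `E_i` are pairwise disjoint and `{min E_i} ∈ S_n`. -/
def IsAllowable (n : ℕ) {k : ℕ} (E : Fin k → Finset ℕ+) : Prop :=
  (∀ i j, i ≠ j → Disjoint (E i) (E j)) ∧
  ∃ h : ∀ i, (E i).Nonempty, Finset.univ.image (fun i => (E i).min' (h i)) ∈ schreier n

/-! ### Norms on `c₀₀` and their completions -/

/-- `N` is a norm on `c₀₀` for which the unit vectors are normalized and 1-unconditional.
(Nonnegativity and definiteness follow.) -/
structure IsLatticeNorm (N : C00 → ℝ) : Prop where
  add_le : ∀ x y, N (x + y) ≤ N x + N y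
  smul : ∀ (c : ℝ) x, N (c • x) = |c| * N x
  mono : ∀ x y : C00, (∀ i, |x i| ≤ |y i|) → N x ≤ N y
  single : ∀ i, N (Finsupp.single i 1) = 1

/-- Norms on `c₀₀` for which the unit vectors are normalized and 1-unconditional. -/
structure LatticeNorm where
  toFun : C00 → ℝ
  isNorm : IsLatticeNorm toFun

namespace IsLatticeNorm

theorem zero {N : C00 → ℝ} (h : IsLatticeNorm N) : N 0 = 0 := by simpa using h.smul 0 0

theorem nonneg {N : C00 → ℝ} (h : IsLatticeNorm N) (x : C00) : 0 ≤ N x := by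
  have := h.mono 0 x (by simp)
  rwa [h.zero] at this

theorem abs_le {N : C00 → ℝ} (h : IsLatticeNorm N) (x : C00) (i : ℕ+) : |x i| ≤ N x := by
  have h1 := h.mono (x i • Finsupp.single i 1) x (by
    intro j
    by_cases hj : i = j
    · subst hj; simp
    · simp [hj])
  rwa [h.smul, h.single, mul_one] at h1

theorem le_l1 {N : C00 → ℝ} (h : IsLatticeNorm N) (x : C00) : N x ≤ ∑ i ∈ x.support, |x i| := by
  have h1 := Finset.le_sum_of_subadditive N h.zero.le (fun a b => h.add_le a b) x.support
    (fun i => x i • Finsupp.single i (1 : ℝ))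
  have h2 : ∑ i ∈ x.support, x i • Finsupp.single i (1 : ℝ) = x := by
    conv_rhs => rw [← Finsupp.sum_single x]
    simp [Finsupp.sum]
  rw [h2] at h1
  simpa only [h.smul, h.single, mul_one] using h1

theorem eq_zero {N : C00 → ℝ} (h : IsLatticeNorm N) (x : C00) (hx : N x = 0) : x = 0 := by
  ext i
  have := h.abs_le x i
  rw [hx] at this
  simpa using this

end IsLatticeNorm

/-- `c₀₀` with the norm `N`. -/
def LatticeNorm.Normed (_N : LatticeNorm) : Type := C00

instance (N : LatticeNorm) : AddCommGroup N.Normed := inferInstanceAs (AddCommGroup C00)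

instance (N : LatticeNorm) : Module ℝ N.Normed := inferInstanceAs (Module ℝ C00)

instance (N : LatticeNorm) : Norm N.Normed := ⟨N.toFun⟩

theorem LatticeNorm.core (N : LatticeNorm) : NormedSpace.Core ℝ N.Normed where
  norm_nonneg x := N.isNorm.nonneg x
  norm_smul c x := N.isNorm.smul c x
  norm_triangle x y := N.isNorm.add_le x y
  norm_eq_zero_iff x := ⟨N.isNorm.eq_zero x, fun hx => by subst hx; exact N.isNorm.zero⟩

instance (N : LatticeNorm) : NormedAddCommGroup N.Normed := NormedAddCommGroup.ofCore N.core

instance (N : LatticeNorm) : NormedSpace ℝ N.Normed := NormedSpace.ofCore N.core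

/-- The Banach space with basis `(e_i)` given by the norm `N`: the completion of `(c₀₀, N)`. -/
abbrev LatticeNorm.Space (N : LatticeNorm) : Type := UniformSpace.Completion N.Normed

theorem restr_apply (E : Finset ℕ+) (x : C00) (i : ℕ+) :
    restr E x i = if i ∈ E then x i else 0 := by
  simp [restr, Finsupp.filter_apply]

theorem restr_add (E : Finset ℕ+) (x y : C00) : restr E (x + y) = restr E x + restr E y :=
  Finsupp.filter_add

theorem restr_smul (E : Finset ℕ+) (c : ℝ) (x : C00) : restr E (c • x) = c • restr E x :=
  Finsupp.filter_smul

theorem IsLatticeNorm.sum_restr_le {N : C00 → ℝ} (h : IsLatticeNorm N) {k : ℕ}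
    (E : Fin k → Finset ℕ+) (hE : ∀ i j, i ≠ j → Disjoint (E i) (E j)) (x : C00) :
    ∑ i, N (restr (E i) x) ≤ ∑ i ∈ x.support, |x i| := by
  have h1 : ∀ i, N (restr (E i) x) ≤ ∑ j ∈ x.support.filter (fun j => j ∈ E i), |x j| := by
    intro i
    refine (h.le_l1 _).trans_eq ?_
    have : (restr (E i) x).support = x.support.filter (fun j => j ∈ E i) := by
      simp [restr]
    rw [this]
    refine Finset.sum_congr rfl fun j hj => ?_
    rw [restr_apply, if_pos (Finset.mem_filter.1 hj).2]
  refine (Finset.sum_le_sum fun i _ => h1 i).trans ?_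
  rw [← Finset.sum_biUnion]
  · refine Finset.sum_le_sum_of_subset_of_nonneg ?_ fun _ _ _ => abs_nonneg _
    intro j hj
    simp only [Finset.mem_biUnion, Finset.mem_filter] at hj
    obtain ⟨_, _, hj, _⟩ := hj
    exact hj
  · intro i _ j _ hij
    refine Finset.disjoint_left.2 fun a ha hb => ?_
    exact Finset.disjoint_left.1 (hE i j hij) (Finset.mem_filter.1 ha).2 (Finset.mem_filter.1 hb).2

theorem sum_restr_single_le {N : C00 → ℝ} (h : IsLatticeNorm N) {k : ℕ}
    (E : Fin k → Finset ℕ+) (hE : ∀ i j, i ≠ j → Disjoint (E i) (E j)) (i : ℕ+) :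
    ∑ j, N (restr (E j) (Finsupp.single i 1)) ≤ 1 := by
  refine (h.sum_restr_le E hE _).trans_eq ?_
  rw [Finset.sum_eq_single i]
  · simp
  · intro b _ hb
    simp [Finsupp.single_apply, hb.symm]
  · intro hi
    simp at hi

theorem bddAbove_supNorm (x : C00) : BddAbove (Set.range fun i => |x i|) := by
  refine ⟨∑ i ∈ x.support, |x i|, ?_⟩
  rintro _ ⟨i, rfl⟩
  by_cases hi : i ∈ x.support
  · exact Finset.single_le_sum (f := fun i => |x i|) (fun _ _ => abs_nonneg _) hi
  · simp only [Finsupp.mem_support_iff, not_not] at hi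
    simp only [hi, abs_zero]
    exact Finset.sum_nonneg fun _ _ => abs_nonneg _

theorem supNorm_isNorm : IsLatticeNorm supNorm where
  add_le x y := ciSup_le fun i => (abs_add_le _ _).trans
    (add_le_add (le_ciSup (bddAbove_supNorm x) i) (le_ciSup (bddAbove_supNorm y) i))
  smul c x := by
    simp only [supNorm, Finsupp.smul_apply, smul_eq_mul, abs_mul]
    rw [Real.mul_iSup_of_nonneg (abs_nonneg c)]
  mono x y hxy := ciSup_le fun i => (hxy i).trans (le_ciSup (bddAbove_supNorm y) i)
  single i := by
    refine le_antisymm (ciSup_le fun j => ?_) ?_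
    · by_cases hj : i = j <;> simp [hj]
    · have := le_ciSup (bddAbove_supNorm (Finsupp.single i 1)) i
      simpa [supNorm] using this

theorem sqrt_le_of_forall {a b c : ℝ} (ha : 0 ≤ a) (hb : 0 ≤ b)
    (hc : ∀ t : ℝ, 0 < t → c ≤ (1 + t) * a + (1 + t⁻¹) * b) : √c ≤ √a + √b := by
  refine le_of_forall_pos_le_add fun ε hε => ?_
  set p := √a + ε / 2 with hp
  set q := √b + ε / 2 with hq
  have hp0 : 0 < p := by positivity
  have hq0 : 0 < q := by positivity
  have h1 : a ≤ p ^ 2 := by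
    rw [← Real.sq_sqrt ha]; gcongr; linarith
  have h2 : b ≤ q ^ 2 := by
    rw [← Real.sq_sqrt hb]; gcongr; linarith
  have h3 := hc (q / p) (by positivity)
  have h4 : (1 + q / p) * a + (1 + (q / p)⁻¹) * b ≤
      (1 + q / p) * p ^ 2 + (1 + (q / p)⁻¹) * q ^ 2 := by gcongr
  have h5 : (1 + q / p) * p ^ 2 + (1 + (q / p)⁻¹) * q ^ 2 = (p + q) ^ 2 := by
    field_simp; ring
  have h6 : c ≤ (p + q) ^ 2 := by linarith
  have := Real.sqrt_le_sqrt h6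
  rw [Real.sqrt_sq (by positivity)] at this
  linarith

theorem sq_add_le (u v t : ℝ) (ht : 0 < t) :
    (u + v) ^ 2 ≤ (1 + t) * u ^ 2 + (1 + t⁻¹) * v ^ 2 := by
  have h : (1 + t) * u ^ 2 + (1 + t⁻¹) * v ^ 2 - (u + v) ^ 2 = t⁻¹ * (t * u - v) ^ 2 := by
    field_simp; ring
  have : 0 ≤ t⁻¹ * (t * u - v) ^ 2 := by positivity
  linarith

theorem sq_apply (x : C00) (i : ℕ+) : sq x i = x i ^ 2 := by simp [sq]

/-- The 2-convexification: the norm `‖x‖_(2) = ‖x ^ 2‖ ^ (1/2)` on `c₀₀`.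
Since the unit vectors form an unconditional basis of the completion `X` of `(c₀₀, N)`, the space
`X^(2)` of all sequences `x` with `x ^ 2 ∈ X` is the completion of `c₀₀` under this norm. -/
def LatticeNorm.convexification (N : LatticeNorm) : LatticeNorm where
  toFun x := √(N.toFun (sq x))
  isNorm :=
    { add_le := fun x y => by
        refine sqrt_le_of_forall (N.isNorm.nonneg _) (N.isNorm.nonneg _) fun t ht => ?_
        have h1 : N.toFun (sq (x + y)) ≤ N.toFun ((1 + t) • sq x + (1 + t⁻¹) • sq y) := by
          refine N.isNorm.mono _ _ fun i => ?_
          simp only [sq_apply, Finsupp.add_apply, Finsupp.smul_apply, smul_eq_mul]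
          rw [abs_of_nonneg (by positivity), abs_of_nonneg (by positivity)]
          exact sq_add_le _ _ t ht
        refine h1.trans ((N.isNorm.add_le _ _).trans_eq ?_)
        rw [N.isNorm.smul, N.isNorm.smul, abs_of_pos (by positivity), abs_of_pos (by positivity)]
      smul := fun c x => by
        have : sq (c • x) = c ^ 2 • sq x := by
          ext i; simp [sq_apply, mul_pow]
        rw [this, N.isNorm.smul, abs_of_nonneg (sq_nonneg c), Real.sqrt_mul (sq_nonneg c),
          Real.sqrt_sq_eq_abs]
      mono := fun x y hxy => by
        refine Real.sqrt_le_sqrt (N.isNorm.mono _ _ fun i => ?_)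
        rw [sq_apply, sq_apply, abs_pow, abs_pow]
        exact pow_le_pow_left₀ (abs_nonneg _) (hxy i) 2
      single := fun i => by
        have : sq (Finsupp.single i 1) = Finsupp.single i 1 := by simp [sq]
        rw [this, N.isNorm.single, Real.sqrt_one] }

/-- Weight sequences: `α_n ∈ (0,1)`, `∑ α_n = 1`, and the ratios `α_{n+1}/α_n` are bounded away
from `0` and from `1`. -/
structure IsWeight (α : ℕ+ → ℝ) : Prop where
  mem : ∀ n, 0 < α n ∧ α n < 1
  sum : HasSum α 1
  ratio : ∃ l u : ℝ, 0 < l ∧ u < 1 ∧ ∀ n, l ≤ α (n + 1) / α n ∧ α (n + 1) / α n ≤ u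

theorem IsWeight.summable {α : ℕ+ → ℝ} (hα : IsWeight α) {f : ℕ+ → ℝ} {B : ℝ}
    (h0 : ∀ n, 0 ≤ f n) (h1 : ∀ n, f n ≤ B) : Summable fun n => α n * f n :=
  Summable.of_nonneg_of_le (fun n => mul_nonneg (hα.mem n).1.le (h0 n))
    (fun n => mul_le_mul_of_nonneg_left (h1 n) (hα.mem n).1.le) (hα.sum.summable.mul_right B)

/-- The norm of `Σ(α_n ‖·‖_n)`, namely `‖x‖ = ∑_{n ≥ 1} α_n ‖x‖_n`. -/
def weightedSum (α : ℕ+ → ℝ) (hα : IsWeight α) (N : ℕ+ → C00 → ℝ)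
    (hN : ∀ n, IsLatticeNorm (N n)) : LatticeNorm where
  toFun x := ∑' n, α n * N n x
  isNorm :=
    have hs : ∀ x, Summable fun n => α n * N n x := fun x =>
      hα.summable (fun n => (hN n).nonneg x) (fun n => (hN n).le_l1 x)
    { add_le := fun x y => by
        rw [← (hs x).tsum_add (hs y)]
        refine (hs _).tsum_le_tsum (fun n => ?_) ((hs x).add (hs y))
        rw [← mul_add]
        exact mul_le_mul_of_nonneg_left ((hN n).add_le x y) (hα.mem n).1.le
      smul := fun c x => by
        rw [← tsum_mul_left]
        refine tsum_congr fun n => ?_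
        rw [(hN n).smul]; ring
      mono := fun x y hxy => (hs x).tsum_le_tsum
        (fun n => mul_le_mul_of_nonneg_left ((hN n).mono x y hxy) (hα.mem n).1.le) (hs y)
      single := fun i => by
        simp only [(hN _).single, mul_one]
        exact hα.sum.tsum_eq }

/-! ### The spaces `V'` and `W'` -/

/-- Conditions, for each `n ≥ 1`, on finite families `E_1, …, E_k` of finite sets. -/
abbrev FamilyCondition : Type := ℕ+ → (k : ℕ) → (Fin k → Finset ℕ+) → Prop

/-- `‖x‖_0 = ‖x‖_∞` and
`‖x‖_{m+1} = ‖x‖_∞ ∨ sup {θ_n ∑_i ‖E_i x‖_m : n ≥ 1, (E_i) satisfies P n}`. -/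
def iterNorm (θ : ℕ+ → ℝ) (P : FamilyCondition) : ℕ → C00 → ℝ
  | 0, x => supNorm x
  | m + 1, x => max (supNorm x)
      (sSup {r | ∃ (n : ℕ+) (k : ℕ) (E : Fin k → Finset ℕ+), P n k E ∧
        r = θ n * ∑ i, iterNorm θ P m (restr (E i) x)})

/-- For `V`: the family is `S_n`-allowable. -/
def condV : FamilyCondition := fun n _ E => IsAllowable n E

/-- For `W`: the family is `S_n`-allowable if `n ≤ s`, and `S_n`-admissible if `n ≥ s + 1`. -/
def condW (s : ℕ+) : FamilyCondition := fun n _ E =>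
  (n ≤ s ∧ IsAllowable n E) ∨ (s + 1 ≤ n ∧ IsAdmissible n E)

theorem IsAdmissible.disjoint {n k : ℕ} {E : Fin k → Finset ℕ+} (h : IsAdmissible n E) :
    ∀ i j, i ≠ j → Disjoint (E i) (E j) := by
  intro i j hij
  refine Finset.disjoint_left.2 fun a ha hb => ?_
  rcases lt_or_gt_of_ne hij with h1 | h1
  · exact lt_irrefl _ (h.1 i j h1 a ha a hb)
  · exact lt_irrefl _ (h.1 j i h1 a hb a ha)

theorem condV_disjoint (n : ℕ+) (k : ℕ) (E : Fin k → Finset ℕ+) (h : condV n k E) :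
    ∀ i j, i ≠ j → Disjoint (E i) (E j) := h.1

theorem condW_disjoint (s : ℕ+) (n : ℕ+) (k : ℕ) (E : Fin k → Finset ℕ+) (h : condW s n k E) :
    ∀ i j, i ≠ j → Disjoint (E i) (E j) := by
  rcases h with h | h
  · exact h.2.1
  · exact h.2.disjoint

open scoped Pointwise in
theorem iterNorm_isNorm (θ : ℕ+ → ℝ) (hθ : ∀ n, 0 < θ n ∧ θ n < 1) (P : FamilyCondition)
    (hP : ∀ n k E, P n k E → ∀ i j, i ≠ j → Disjoint (E i) (E j)) (m : ℕ) :
    IsLatticeNorm (iterNorm θ P m) := by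
  induction m with
  | zero => exact supNorm_isNorm
  | succ m ih =>
    set A : C00 → Set ℝ := fun x => {r | ∃ (n : ℕ+) (k : ℕ) (E : Fin k → Finset ℕ+), P n k E ∧
        r = θ n * ∑ i, iterNorm θ P m (restr (E i) x)} with hA
    have hdef : ∀ x, iterNorm θ P (m + 1) x = max (supNorm x) (sSup (A x)) := fun x => rfl
    have hle : ∀ n k E, P n k E → ∀ x, θ n * ∑ i, iterNorm θ P m (restr (E i) x) ≤
        ∑ i, iterNorm θ P m (restr (E i) x) := fun n k E _ x =>
      mul_le_of_le_one_left (Finset.sum_nonneg fun i _ => ih.nonneg _) (hθ n).2.le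
    have hbdd : ∀ x, BddAbove (A x) := by
      intro x
      refine ⟨∑ i ∈ x.support, |x i|, ?_⟩
      rintro _ ⟨n, k, E, hE, rfl⟩
      exact (hle n k E hE x).trans (ih.sum_restr_le E (hP n k E hE) x)
    have hnn : ∀ x, 0 ≤ sSup (A x) := by
      intro x
      refine Real.sSup_nonneg ?_
      rintro _ ⟨n, k, E, hE, rfl⟩
      exact mul_nonneg (hθ n).1.le (Finset.sum_nonneg fun i _ => ih.nonneg _)
    refine ⟨fun x y => ?_, fun c x => ?_, fun x y hxy => ?_, fun i => ?_⟩
    · simp only [hdef]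
      refine max_le ((supNorm_isNorm.add_le x y).trans
        (add_le_add (le_max_left _ _) (le_max_left _ _))) ?_
      refine le_trans ?_ (add_le_add (le_max_right (supNorm x) _) (le_max_right (supNorm y) _))
      refine Real.sSup_le ?_ (add_nonneg (hnn x) (hnn y))
      rintro _ ⟨n, k, E, hE, rfl⟩
      refine le_trans ?_ (add_le_add (le_csSup (hbdd x) ⟨n, k, E, hE, rfl⟩)
        (le_csSup (hbdd y) ⟨n, k, E, hE, rfl⟩))
      rw [← mul_add, ← Finset.sum_add_distrib]
      refine mul_le_mul_of_nonneg_left (Finset.sum_le_sum fun i _ => ?_) (hθ n).1.le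
      rw [restr_add]
      exact ih.add_le _ _
    · simp only [hdef, supNorm_isNorm.smul]
      have : A (c • x) = |c| • A x := by
        ext r
        simp only [hA, Set.mem_ofPred_eq, Set.mem_smul_set, restr_smul, ih.smul, ← Finset.mul_sum,
          smul_eq_mul]
        constructor
        · rintro ⟨n, k, E, hE, rfl⟩
          exact ⟨_, ⟨n, k, E, hE, rfl⟩, by ring⟩
        · rintro ⟨_, ⟨n, k, E, hE, rfl⟩, rfl⟩
          exact ⟨n, k, E, hE, by ring⟩
      rw [this, Real.sSup_smul_of_nonneg (abs_nonneg c), smul_eq_mul,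
        mul_max_of_nonneg _ _ (abs_nonneg c)]
    · simp only [hdef]
      refine max_le_max (supNorm_isNorm.mono x y hxy) (Real.sSup_le ?_ (hnn y))
      rintro _ ⟨n, k, E, hE, rfl⟩
      refine le_trans ?_ (le_csSup (hbdd y) ⟨n, k, E, hE, rfl⟩)
      refine mul_le_mul_of_nonneg_left (Finset.sum_le_sum fun i _ => ?_) (hθ n).1.le
      refine ih.mono _ _ fun j => ?_
      simp only [restr_apply]
      split_ifs
      · exact hxy j
      · simp
    · simp only [hdef, supNorm_isNorm.single]
      refine max_eq_left (Real.sSup_le ?_ zero_le_one)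
      rintro _ ⟨n, k, E, hE, rfl⟩
      exact (hle n k E hE _).trans (sum_restr_single_le ih E (hP n k E hE) i)

/-- The norm of `V' = Σ(α_n ‖·‖_{V,n})`. -/
def normV' (θ : ℕ+ → ℝ) (hθ : ∀ n, 0 < θ n ∧ θ n < 1) (α : ℕ+ → ℝ) (hα : IsWeight α) :
    LatticeNorm :=
  weightedSum α hα (fun n => iterNorm θ condV n)
    (fun n => iterNorm_isNorm θ hθ condV condV_disjoint n)

/-- The norm of `W' = Σ(α_n ‖·‖_{W,n})`. -/
def normW' (θ : ℕ+ → ℝ) (hθ : ∀ n, 0 < θ n ∧ θ n < 1) (s : ℕ+) (α : ℕ+ → ℝ) (hα : IsWeight α) :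
    LatticeNorm :=
  weightedSum α hα (fun n => iterNorm θ (condW s) n)
    (fun n => iterNorm_isNorm θ hθ (condW s) (condW_disjoint s) n)

/-! ### Edgington's spaces -/

/-- `‖x‖_{E,0} = ‖x‖_∞` and
`‖x‖_{E,n+1}² = sup {∑_i ‖E_i x‖_{E,n}² : (E_i) is S_1-admissible}`. -/
def edgingtonSeq : ℕ → C00 → ℝ
  | 0, x => supNorm x
  | n + 1, x => √(sSup {r | ∃ (k : ℕ) (E : Fin k → Finset ℕ+), IsAdmissible 1 E ∧
      r = ∑ i, edgingtonSeq n (restr (E i) x) ^ 2})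

theorem singleton_admissible (i : ℕ+) : IsAdmissible 1 (fun _ : Fin 1 => ({i} : Finset ℕ+)) := by
  refine ⟨fun a b hab => absurd hab (by simp [Subsingleton.elim a b]), fun _ => by simp, ?_⟩
  refine ⟨1, fun _ => {i}, fun _ => Or.inr ⟨i, rfl⟩, fun _ a _ => (one_le : 1 ≤ a), ?_, ?_⟩
  · intro a b hab
    exact absurd hab ((Subsingleton.elim (α := Fin 1) a b) ▸ lt_irrefl (α := Fin 1) a)
  · ext j
    constructor
    · intro hj
      simp at hj
      exact Finset.mem_biUnion.2 ⟨⟨0, by decide⟩, Finset.mem_univ _, by simpa using hj⟩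
    · intro hj
      simpa using (Finset.mem_biUnion.1 hj).choose_spec.2

open scoped Pointwise in
theorem edgingtonSeq_isNorm (n : ℕ) : IsLatticeNorm (edgingtonSeq n) := by
  induction n with
  | zero => exact supNorm_isNorm
  | succ m ih =>
    set A : C00 → Set ℝ := fun x => {r | ∃ (k : ℕ) (E : Fin k → Finset ℕ+), IsAdmissible 1 E ∧
      r = ∑ i, edgingtonSeq m (restr (E i) x) ^ 2} with hA
    have hdef : ∀ x, edgingtonSeq (m + 1) x = √(sSup (A x)) := fun x => rfl
    have hle : ∀ (k : ℕ) (E : Fin k → Finset ℕ+) x, ∑ i, edgingtonSeq m (restr (E i) x) ^ 2 ≤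
        (∑ i, edgingtonSeq m (restr (E i) x)) ^ 2 := fun k E x =>
      Finset.sum_sq_le_sq_sum_of_nonneg fun i _ => ih.nonneg _
    have hbdd : ∀ x, BddAbove (A x) := by
      intro x
      refine ⟨(∑ i ∈ x.support, |x i|) ^ 2, ?_⟩
      rintro _ ⟨k, E, hE, rfl⟩
      exact (hle k E x).trans (pow_le_pow_left₀ (Finset.sum_nonneg fun i _ => ih.nonneg _)
        (ih.sum_restr_le E hE.disjoint x) 2)
    have hnn : ∀ x, 0 ≤ sSup (A x) := by
      intro x
      refine Real.sSup_nonneg ?_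
      rintro _ ⟨k, E, hE, rfl⟩
      exact Finset.sum_nonneg fun i _ => sq_nonneg _
    refine ⟨fun x y => ?_, fun c x => ?_, fun x y hxy => ?_, fun i => ?_⟩
    · simp only [hdef]
      refine sqrt_le_of_forall (hnn x) (hnn y) fun t ht => ?_
      have ht' := inv_pos.2 ht
      refine Real.sSup_le ?_ (add_nonneg (mul_nonneg (by positivity) (hnn x))
        (mul_nonneg (by positivity) (hnn y)))
      rintro _ ⟨k, E, hE, rfl⟩
      refine le_trans ?_ (add_le_add
        (mul_le_mul_of_nonneg_left (le_csSup (hbdd x) ⟨k, E, hE, rfl⟩) (by positivity))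
        (mul_le_mul_of_nonneg_left (le_csSup (hbdd y) ⟨k, E, hE, rfl⟩) (by positivity)))
      rw [Finset.mul_sum, Finset.mul_sum, ← Finset.sum_add_distrib]
      refine Finset.sum_le_sum fun i _ => le_trans ?_ (sq_add_le _ _ t ht)
      rw [restr_add]
      exact pow_le_pow_left₀ (ih.nonneg _) (ih.add_le _ _) 2
    · simp only [hdef]
      have : A (c • x) = (c ^ 2) • A x := by
        ext r
        simp only [hA, Set.mem_ofPred_eq, Set.mem_smul_set, restr_smul, ih.smul, mul_pow,
          ← Finset.mul_sum, smul_eq_mul, sq_abs]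
        constructor
        · rintro ⟨k, E, hE, rfl⟩
          exact ⟨_, ⟨k, E, hE, rfl⟩, rfl⟩
        · rintro ⟨_, ⟨k, E, hE, rfl⟩, rfl⟩
          exact ⟨k, E, hE, rfl⟩
      rw [this, Real.sSup_smul_of_nonneg (sq_nonneg c), smul_eq_mul, Real.sqrt_mul (sq_nonneg c),
        Real.sqrt_sq_eq_abs]
    · simp only [hdef]
      refine Real.sqrt_le_sqrt (Real.sSup_le ?_ (hnn y))
      rintro _ ⟨k, E, hE, rfl⟩
      refine le_trans ?_ (le_csSup (hbdd y) ⟨k, E, hE, rfl⟩)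
      refine Finset.sum_le_sum fun i _ => pow_le_pow_left₀ (ih.nonneg _) ?_ 2
      refine ih.mono _ _ fun j => ?_
      simp only [restr_apply]
      split_ifs
      · exact hxy j
      · simp
    · rw [hdef, Real.sqrt_eq_one]
      refine le_antisymm (Real.sSup_le ?_ zero_le_one) (le_csSup (hbdd _) ?_)
      · rintro _ ⟨k, E, hE, rfl⟩
        refine (hle k E _).trans (pow_le_one₀ (Finset.sum_nonneg fun i _ => ih.nonneg _) ?_)
        exact sum_restr_single_le ih E hE.disjoint i
      · refine ⟨1, fun _ => {i}, singleton_admissible i, ?_⟩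
        have : restr {i} (Finsupp.single i 1) = Finsupp.single i 1 := by
          ext j
          rw [restr_apply]
          by_cases hj : i = j
          · simp [hj]
          · simp [hj]
        simp [this, ih.single]

/-- The norm of Edgington's space `E_β`: `‖x‖ = (∑_{n ≥ 1} β_n ‖x‖_{E,n}²)^{1/2}`. -/
def normE (β : ℕ+ → ℝ) (hβ : IsWeight β) : LatticeNorm where
  toFun x := √(∑' n : ℕ+, β n * edgingtonSeq n x ^ 2)
  isNorm :=
    have hs : ∀ x, Summable fun n : ℕ+ => β n * edgingtonSeq n x ^ 2 := fun x =>
      hβ.summable (fun n => sq_nonneg _) (fun n => pow_le_pow_left₀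
        ((edgingtonSeq_isNorm n).nonneg x) ((edgingtonSeq_isNorm n).le_l1 x) 2)
    have hnn : ∀ x, 0 ≤ ∑' n : ℕ+, β n * edgingtonSeq n x ^ 2 := fun x =>
      tsum_nonneg fun n => mul_nonneg (hβ.mem n).1.le (sq_nonneg _)
    { add_le := fun x y => by
        refine sqrt_le_of_forall (hnn x) (hnn y) fun t ht => ?_
        rw [← tsum_mul_left, ← tsum_mul_left,
          ← ((hs x).mul_left _).tsum_add ((hs y).mul_left _)]
        refine (hs _).tsum_le_tsum (fun n => ?_) (((hs x).mul_left _).add ((hs y).mul_left _))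
        have h1 := pow_le_pow_left₀ ((edgingtonSeq_isNorm n).nonneg _)
          ((edgingtonSeq_isNorm n).add_le x y) 2
        have h2 := mul_le_mul_of_nonneg_left
          (h1.trans (sq_add_le _ _ t ht)) (hβ.mem n).1.le
        refine h2.trans_eq (by ring)
      smul := fun c x => by
        rw [← Real.sqrt_sq_eq_abs, ← Real.sqrt_mul (sq_nonneg c), ← tsum_mul_left]
        congr 1
        refine tsum_congr fun n => ?_
        rw [(edgingtonSeq_isNorm n).smul, mul_pow, sq_abs]; ring
      mono := fun x y hxy => Real.sqrt_le_sqrt ((hs x).tsum_le_tsum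
        (fun n => mul_le_mul_of_nonneg_left (pow_le_pow_left₀ ((edgingtonSeq_isNorm n).nonneg x)
          ((edgingtonSeq_isNorm n).mono x y hxy) 2) (hβ.mem n).1.le) (hs y))
      single := fun i => by
        simp only [(edgingtonSeq_isNorm _).single, one_pow, mul_one]
        rw [hβ.sum.tsum_eq, Real.sqrt_one] }

end WeakHilbert

end

namespace WeakHilbert

/-! ### Schreier families -/

/-! Both `V'` and `W'` satisfy a lower estimate c θ_n ∑ ‖E_i x‖ ≤ ‖x‖ for S_n-admissible families,
with one c for all n (`weightedSum_hasLowerEstimate`). The squared norm of the 2-convexification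
inherits it. As θ_n^{1/n} → 1, this loss is subexponential in n. In Edgington's space, S_n-averages
are exponentially small: ‖x‖_{E,m}² is at most the largest sum of x_i² over a set in S_m
(`edgingtonSeq_sq_le`). So a vector of the ℓ_2 ball with little mass on all S_m-sets, m < n, feels
only the weights β_m with m ≥ n, which decay geometrically (`exists_normE_sq_le`).

An isomorphism would bring these two facts into conflict. The images of the unit vectors, perturbed
into c₀₀, form vectors u_i. Edgington's norm is dominated by that of ℓ_2, so their coordinates tend
to 0 (`tendsto_coord`), and a sliding hump gives u_{q_k} essentially supported on [p_k, p_{k+1}). No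
matching of the two bases is needed: repeated averages (`exists_schreier_average`) supply
probabilities b whose support is in S_n along p, but which give S_m-sets, m < n, small measure along
q. Then ∑ √b_k e_{q_k} has squared norm O(w^n) for some w < 1, while its image has squared norm at
least a constant times θ_n. Hence θ_n ≤ C w^n (`exists_le_geometric`), contradicting θ_n^{1/n} → 1.
-/

theorem empty_mem_schreier (m : ℕ) : ∅ ∈ schreier m := by
  cases m with
  | zero => exact Or.inl rfl
  | succ k =>
    refine ⟨1, fun _ => ∅, fun _ => empty_mem_schreier k, by simp, ?_, by ext; simp⟩
    intro i j _ a ha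
    simp at ha

/-- The Schreier families are hereditary. -/
theorem schreier_subset (m : ℕ) {F G : Finset ℕ+} (hF : F ∈ schreier m) (hGF : G ⊆ F) :
    G ∈ schreier m := by
  induction m generalizing F G with
  | zero =>
    rcases hF with rfl | ⟨n, rfl⟩
    · exact Or.inl (Finset.subset_empty.1 hGF)
    · rcases Finset.subset_singleton_iff.1 hGF with h | h
      · exact Or.inl h
      · exact Or.inr ⟨n, h⟩
  | succ k ih =>
    obtain ⟨n, H, h1, h2, h3, rfl⟩ := hF
    refine ⟨n, fun i => H i ∩ G, fun i => ih (h1 i) Finset.inter_subset_left,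
      fun i a ha => h2 i a (Finset.mem_inter.1 ha).1, fun i j hij a ha b hb =>
        h3 i j hij a (Finset.mem_inter.1 ha).1 b (Finset.mem_inter.1 hb).1, ?_⟩
    ext a
    have := @hGF a
    simp only [Finset.mem_biUnion, Finset.mem_univ, true_and, Finset.mem_inter] at this ⊢
    constructor
    · intro ha
      obtain ⟨i, hi⟩ := this ha
      exact ⟨i, hi, ha⟩
    · rintro ⟨i, _, ha⟩
      exact ha

/-- An `S_1`-admissible family of `k` sets lies in `[k, ∞)`. -/
theorem IsAdmissible.card_le {k : ℕ} {E : Fin k → Finset ℕ+} (hE : IsAdmissible 1 E) (i : Fin k)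
    {a : ℕ+} (ha : a ∈ E i) : k ≤ a := by
  obtain ⟨hlt, hne, n, G, hG0, hGn, -, hG⟩ := hE
  have hinj : Function.Injective fun i => (E i).min' (hne i) := by
    intro i j hij
    by_contra hne'
    rcases lt_or_gt_of_ne hne' with h | h
    · exact (hlt i j h _ (Finset.min'_mem _ _) _ (Finset.min'_mem _ _)).ne hij
    · exact (hlt j i h _ (Finset.min'_mem _ _) _ (Finset.min'_mem _ _)).ne hij.symm
  -- The k distinct minima are covered by n sets from S_0, each with at most one element.
  have h1 : k ≤ n := by
    have hc := congrArg Finset.card hG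
    rw [Finset.card_image_of_injective _ hinj, Finset.card_univ, Fintype.card_fin] at hc
    rw [hc]
    refine Finset.card_biUnion_le.trans ((Finset.sum_le_card_nsmul _ _ 1 fun j _ => ?_).trans ?_)
    · rcases hG0 j with h | ⟨b, h⟩ <;> rw [h] <;> simp
    · simp
  have h2 : (E i).min' (hne i) ∈ Finset.univ.biUnion G := by
    rw [← hG]
    exact Finset.mem_image_of_mem _ (Finset.mem_univ i)
  obtain ⟨j, -, hj⟩ := Finset.mem_biUnion.1 h2
  have h3 : (n : ℕ+) ≤ a := (hGn j _ hj).trans (Finset.min'_le _ _ ha)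
  exact h1.trans (by exact_mod_cast h3)

/-! ### Upper estimates for Edgington's norms -/

theorem supNorm_sq_le (x : C00) : ∃ G ∈ schreier 0, supNorm x ^ 2 ≤ ∑ i ∈ G, x i ^ 2 := by
  by_cases hx : x.support.Nonempty
  · obtain ⟨j, -, hj⟩ := Finset.exists_max_image x.support (fun i => |x i|) hx
    refine ⟨{j}, Or.inr ⟨j, rfl⟩, ?_⟩
    rw [Finset.sum_singleton, ← sq_abs (x j)]
    refine pow_le_pow_left₀ (supNorm_isNorm.nonneg x) (ciSup_le fun i => ?_) 2
    by_cases hi : i ∈ x.support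
    · exact hj i hi
    · simp only [Finsupp.mem_support_iff, not_not] at hi
      simp [hi]
  · refine ⟨∅, Or.inl rfl, ?_⟩
    rw [Finset.not_nonempty_iff_eq_empty, Finsupp.support_eq_empty] at hx
    simp [hx, supNorm_isNorm.zero]

theorem sum_sq_inter_support (G : Finset ℕ+) (x : C00) :
    ∑ i ∈ G ∩ x.support, x i ^ 2 = ∑ i ∈ G, x i ^ 2 := by
  refine Finset.sum_subset Finset.inter_subset_left fun i hi hi' => ?_
  have : x i = 0 := by
    by_contra h
    exact hi' (Finset.mem_inter.2 ⟨hi, Finsupp.mem_support_iff.2 h⟩)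
  simp [this]

/-- By heredity only the finitely many subsets of the support compete. A maximizer is needed because
one G must serve every family in the supremum defining the next norm. -/
theorem exists_schreier_max (m : ℕ) (x : C00) :
    ∃ G ∈ schreier m, ∀ H ∈ schreier m, ∑ i ∈ H, x i ^ 2 ≤ ∑ i ∈ G, x i ^ 2 := by
  classical
  obtain ⟨G, hG, hmax⟩ := Finset.exists_max_image
    (x.support.powerset.filter (fun G => G ∈ schreier m)) (fun G => ∑ i ∈ G, x i ^ 2)
    ⟨∅, by simp [empty_mem_schreier]⟩
  refine ⟨G, (Finset.mem_filter.1 hG).2, fun H hH => ?_⟩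
  rw [← sum_sq_inter_support]
  exact hmax _ (Finset.mem_filter.2 ⟨Finset.mem_powerset.2 Finset.inter_subset_right,
    schreier_subset m hH Finset.inter_subset_left⟩)

/-- `‖x‖_{E,m}²` is at most the supremum of `∑_{i ∈ G} x_i²` over `G ∈ S_m`. -/
theorem edgingtonSeq_sq_le (m : ℕ) (x : C00) :
    ∃ G ∈ schreier m, edgingtonSeq m x ^ 2 ≤ ∑ i ∈ G, x i ^ 2 := by
  induction m generalizing x with
  | zero => exact supNorm_sq_le x
  | succ m ih =>
    obtain ⟨G, hG, hmax⟩ := exists_schreier_max (m + 1) x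
    refine ⟨G, hG, ?_⟩
    have hnn : 0 ≤ ∑ i ∈ G, x i ^ 2 := Finset.sum_nonneg fun _ _ => sq_nonneg _
    rw [edgingtonSeq, Real.sq_sqrt (Real.sSup_nonneg (by
      rintro _ ⟨k, E, hE, rfl⟩
      exact Finset.sum_nonneg fun i _ => sq_nonneg _))]
    refine Real.sSup_le ?_ hnn
    rintro _ ⟨k, E, hE, rfl⟩
    -- The number of pieces in the definition of S_{m+1} is a positive integer, so the empty family
    -- is separate.
    rcases Nat.eq_zero_or_pos k with rfl | hk
    · simpa using hnn
    choose H hH hHle using fun i => ih (restr (E i) x)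
    -- The pieces H_i ∩ E_i are k successive S_m-sets in [k, ∞), which is exactly membership in
    -- S_{m+1}.
    have hmem : Finset.univ.biUnion (fun i => H i ∩ E i) ∈ schreier (m + 1) := by
      refine ⟨⟨k, hk⟩, fun i => H i ∩ E i, fun i => schreier_subset m (hH i)
        Finset.inter_subset_left, fun i a ha => ?_, fun i j hij a ha b hb =>
        hE.1 i j hij a (Finset.mem_inter.1 ha).2 b (Finset.mem_inter.1 hb).2, rfl⟩
      exact hE.card_le i (Finset.mem_inter.1 ha).2
    refine le_trans ?_ (hmax _ hmem)
    rw [Finset.sum_biUnion]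
    · refine Finset.sum_le_sum fun i _ => (hHle i).trans_eq ?_
      rw [← Finset.filter_mem_eq_inter, Finset.sum_filter]
      refine Finset.sum_congr rfl fun j _ => ?_
      rw [restr_apply]
      split_ifs <;> simp
    · intro i _ j _ hij
      exact (hE.disjoint i j hij).mono Finset.inter_subset_right Finset.inter_subset_right

theorem edgingtonSeq_sq_le_l2 (m : ℕ) (x : C00) :
    edgingtonSeq m x ^ 2 ≤ ∑ i ∈ x.support, x i ^ 2 := by
  obtain ⟨G, -, hG⟩ := edgingtonSeq_sq_le m x
  rw [← sum_sq_inter_support] at hG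
  exact hG.trans (Finset.sum_le_sum_of_subset_of_nonneg Finset.inter_subset_right
    fun _ _ _ => sq_nonneg _)

theorem normE_sq (β : ℕ+ → ℝ) (hβ : IsWeight β) (x : C00) :
    (normE β hβ).toFun x ^ 2 = ∑' n : ℕ+, β n * edgingtonSeq n x ^ 2 :=
  Real.sq_sqrt (tsum_nonneg fun n : ℕ+ => mul_nonneg (hβ.mem n).1.le (sq_nonneg _))

theorem normE_sq_le_l2 (β : ℕ+ → ℝ) (hβ : IsWeight β) (x : C00) :
    (normE β hβ).toFun x ^ 2 ≤ ∑ i ∈ x.support, x i ^ 2 := by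
  rw [normE_sq]
  refine ((hβ.summable (fun n => sq_nonneg _) fun n : ℕ+ => edgingtonSeq_sq_le_l2 n x).tsum_le_tsum
    (fun n : ℕ+ => mul_le_mul_of_nonneg_left (edgingtonSeq_sq_le_l2 n x) (hβ.mem n).1.le)
    (hβ.sum.summable.mul_right _)).trans_eq ?_
  rw [tsum_mul_right, hβ.sum.tsum_eq, one_mul]

/-- Weight sequences decay geometrically. -/
theorem IsWeight.exists_le_pow {β : ℕ+ → ℝ} (hβ : IsWeight β) :
    ∃ u : ℝ, 0 < u ∧ u < 1 ∧ ∀ n : ℕ+, u * β n ≤ u ^ (n : ℕ) := by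
  obtain ⟨l, u, hl, hu, h⟩ := hβ.ratio
  have hu0 : 0 < u := hl.trans_le ((h 1).1.trans (h 1).2)
  -- The extra factor u on the left accounts for the indices starting at 1: only β_1 < 1 is known
  -- there.
  refine ⟨u, hu0, hu, fun n => ?_⟩
  induction n using PNat.recOn with
  | one => simpa using mul_le_of_le_one_right hu0.le (hβ.mem 1).2.le
  | succ n ih =>
    have h1 := (div_le_iff₀ (hβ.mem n).1).1 (h n).2
    rw [PNat.add_coe, PNat.one_coe, pow_succ']
    exact mul_le_mul_of_nonneg_left (h1.trans ih) hu0.le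

/-- If `∑_{i ∈ G} x_i²` is small for all `G ∈ S_m` with `m < n`, then the norm of `x` in
Edgington's space is exponentially small in `n`, uniformly over the unit ball of `ℓ_2`. -/
theorem exists_normE_sq_le (β : ℕ+ → ℝ) (hβ : IsWeight β) :
    ∃ C w : ℝ, 0 < w ∧ w < 1 ∧ ∀ (n : ℕ) (ε : ℝ) (x : C00), 0 ≤ ε →
      ∑ i ∈ x.support, x i ^ 2 ≤ 1 → (∀ m < n, ∀ G ∈ schreier m, ∑ i ∈ G, x i ^ 2 ≤ ε) →
      (normE β hβ).toFun x ^ 2 ≤ ε + C * w ^ n := by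
  obtain ⟨u, hu0, hu1, hu⟩ := hβ.exists_le_pow
  -- With w² = u, the bound u^m splits as w^m · w^m. For m ≥ n one factor is at most w^n and the
  -- other is summable over m.
  set w := √u with hw
  have hw0 : 0 < w := Real.sqrt_pos.2 hu0
  have hw1 : w < 1 := by rw [hw, Real.sqrt_lt' one_pos]; simpa using hu1
  have hwu : w ^ 2 = u := Real.sq_sqrt hu0.le
  have hsum : Summable fun m : ℕ+ => w ^ (m : ℕ) :=
    (summable_geometric_of_lt_one hw0.le hw1).comp_injective PNat.coe_injective
  refine ⟨u⁻¹ * ∑' m : ℕ+, w ^ (m : ℕ), w, hw0, hw1, fun n ε x hε hx hG => ?_⟩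
  rw [normE_sq]
  have hterm : ∀ m : ℕ+, β m * edgingtonSeq m x ^ 2 ≤ β m * ε + u⁻¹ * w ^ n * w ^ (m : ℕ) := by
    intro m
    have hβm := (hβ.mem m).1
    rcases lt_or_ge (m : ℕ) n with hm | hm
    · obtain ⟨G, hGm, hle⟩ := edgingtonSeq_sq_le m x
      have := mul_le_mul_of_nonneg_left (hle.trans (hG m hm G hGm)) hβm.le
      have h2 : 0 ≤ u⁻¹ * w ^ n * w ^ (m : ℕ) := by positivity
      linarith
    · have h1 := mul_le_mul_of_nonneg_left ((edgingtonSeq_sq_le_l2 m x).trans hx) hβm.le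
      have h2 : β m ≤ u⁻¹ * w ^ n * w ^ (m : ℕ) := by
        rw [mul_assoc, ← div_eq_inv_mul, le_div_iff₀' hu0]
        refine (hu m).trans ?_
        rw [← hwu, pow_right_comm, pow_two]
        exact mul_le_mul_of_nonneg_right (pow_le_pow_of_le_one hw0.le hw1.le hm) (by positivity)
      have h3 : 0 ≤ β m * ε := by positivity
      linarith
  refine ((hβ.summable (fun n => sq_nonneg _) fun n : ℕ+ => edgingtonSeq_sq_le_l2 n x).tsum_le_tsum
    hterm ((hβ.sum.summable.mul_right ε).add (hsum.mul_left _))).trans_eq ?_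
  rw [(hβ.sum.summable.mul_right ε).tsum_add (hsum.mul_left _), tsum_mul_right, hβ.sum.tsum_eq,
    tsum_mul_left]
  ring

/-! ### Schreier averages -/

/-- The step from `S_n`-averages to sums of `t` successive `S_n`-averages. -/
theorem exists_sum_averages {p q : ℕ → ℕ+} (hp : StrictMono p) (hq : StrictMono q) (n : ℕ)
    (ih : ∀ (ε : ℝ) (K : ℕ), 0 < ε → ∃ (F : Finset ℕ) (b : ℕ → ℝ), (∀ k ∈ F, K ≤ k) ∧
      (∀ k, 0 ≤ b k) ∧ (∀ k ∉ F, b k = 0) ∧ ∑ k ∈ F, b k = 1 ∧ F.image p ∈ schreier n ∧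
      ∀ m < n, ∀ G ∈ schreier m, ∑ k ∈ F with q k ∈ G, b k ≤ ε)
    (r : ℝ) (hr : 0 < r) (K t : ℕ) :
    ∃ (F : Finset ℕ) (b : ℕ → ℝ), (∀ k ∈ F, K ≤ k) ∧
      (∀ k, 0 ≤ b k) ∧ (∀ k ∉ F, b k = 0) ∧ ∑ k ∈ F, b k = t ∧
      (∃ H : ℕ → Finset ℕ+, (∀ i, H i ∈ schreier n) ∧ (∀ i j, i < j → Before (H i) (H j)) ∧
        (∀ i ≥ t, H i = ∅) ∧ F.image p = (Finset.range t).biUnion H) ∧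
      ∀ m < n + 1, ∀ G ∈ schreier m, ∑ k ∈ F with q k ∈ G, b k ≤ 1 + t / r := by
  induction t with
  | zero =>
    refine ⟨∅, fun _ => 0, by simp, by simp, by simp, by simp, ⟨fun _ => ∅,
      fun _ => empty_mem_schreier n, fun i j _ a ha => by simp at ha, by simp, by simp⟩, by simp⟩
  | succ t iht =>
    obtain ⟨F, b, hK, hb0, hbF, hsum, ⟨H, hHn, hHb, hHe, hHF⟩, hG⟩ := iht
    obtain ⟨B, hB⟩ : ∃ B : ℕ, ∀ k ∈ F, k < B :=
      ⟨F.sup id + 1, fun k hk => Nat.lt_succ_of_le (Finset.le_sup (f := id) hk)⟩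
    -- The new average starts beyond F. A set of S_{m+1} meeting the q-image of F is a union of N
    -- sets of S_m with N ≤ q_B, so it gets at most N / (r q_B) ≤ 1/r from the new average.
    obtain ⟨F', b', hK', hb0', hbF', hsum', hF'n, hG'⟩ :=
      ih (1 / (r * (q B : ℕ))) (max K B) (by have := (q B).pos; positivity)
    have hFF' : Disjoint F F' := Finset.disjoint_left.2 fun k hk hk' =>
      absurd (hB k hk) (not_lt.2 ((le_max_right _ _).trans (hK' k hk')))
    have hs : ∀ (P : ℕ → Prop) [DecidablePred P], ∑ k ∈ F ∪ F' with P k, (b k + b' k) =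
        ∑ k ∈ F with P k, b k + ∑ k ∈ F' with P k, b' k := by
      intro P _
      rw [Finset.filter_union, Finset.sum_union (Finset.disjoint_filter_filter hFF')]
      congr 1
      · refine Finset.sum_congr rfl fun k hk => ?_
        rw [hbF' k (Finset.disjoint_left.1 hFF' (Finset.mem_filter.1 hk).1), add_zero]
      · refine Finset.sum_congr rfl fun k hk => ?_
        rw [hbF k (Finset.disjoint_right.1 hFF' (Finset.mem_filter.1 hk).1), zero_add]
    refine ⟨F ∪ F', fun k => b k + b' k, ?_, fun k => add_nonneg (hb0 k) (hb0' k), ?_, ?_, ?_, ?_⟩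
    · intro k hk
      rcases Finset.mem_union.1 hk with h | h
      · exact hK k h
      · exact (le_max_left _ _).trans (hK' k h)
    · intro k hk
      rw [Finset.mem_union, not_or] at hk
      simp only [hbF k hk.1, hbF' k hk.2, add_zero]
    · have := hs (fun _ => True)
      simp only [Finset.filter_true] at this
      rw [this, hsum, hsum']
      push_cast; ring
    · refine ⟨Function.update H t (F'.image p), fun i => ?_, fun i j hij => ?_, fun i hi => ?_, ?_⟩
      · by_cases h : i = t
        · subst h; simpa using hF'n
        · simpa [h] using hHn i
      · by_cases hj : j = t
        · subst hj
          rw [Function.update_self, Function.update_of_ne hij.ne]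
          intro a ha c hc
          have ha' : a ∈ F.image p := by
            rw [hHF]
            exact Finset.mem_biUnion.2 ⟨i, Finset.mem_range.2 hij, ha⟩
          obtain ⟨k, hk, rfl⟩ := Finset.mem_image.1 ha'
          obtain ⟨k', hk', rfl⟩ := Finset.mem_image.1 hc
          exact hp ((hB k hk).trans_le ((le_max_right _ _).trans (hK' k' hk')))
        · rw [Function.update_of_ne hj]
          by_cases hi : i = t
          · rw [hHe j (hi ▸ hij.le)]
            intro a _ c hc
            simp at hc
          · rw [Function.update_of_ne hi]
            exact hHb i j hij
      · rw [Function.update_of_ne (by omega)]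
        exact hHe i (by omega)
      · rw [Finset.image_union, hHF, Finset.range_add_one, Finset.biUnion_insert,
          Function.update_self, Finset.union_comm]
        congr 1
        refine Finset.biUnion_congr rfl fun i hi => ?_
        rw [Function.update_of_ne (Finset.mem_range.1 hi).ne]
    · intro m hm G hGm
      rw [hs (fun k => q k ∈ G)]
      have htr : (1 : ℝ) + t / r + 1 / r = 1 + (t + 1 : ℕ) / r := by push_cast; ring
      -- If G meets the earlier averages, the new one adds at most 1/r. If it misses them, the new
      -- one contributes at most its total mass 1 and the earlier ones nothing.
      by_cases hint : ∃ k ∈ F, q k ∈ G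
      · obtain ⟨k, hkF, hkG⟩ := hint
        rw [← htr]
        refine add_le_add (hG m hm G hGm) ?_
        cases m with
        -- A set of S_0 has at most one point, which is already taken by F.
        | zero =>
          have : ({x ∈ F' | q x ∈ G} : Finset ℕ) = ∅ := by
            refine Finset.filter_eq_empty_iff.2 fun k' hk' hq' => ?_
            rcases hGm with rfl | ⟨g, rfl⟩
            · simp at hkG
            · have := hq.injective ((Finset.mem_singleton.1 hkG).trans
                (Finset.mem_singleton.1 hq').symm)
              subst this
              exact Finset.disjoint_left.1 hFF' hkF hk'
          rw [this, Finset.sum_empty]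
          positivity
        | succ m =>
          obtain ⟨N, J, hJ, hJN, -, rfl⟩ := hGm
          have hN : (N : ℕ) ≤ (q B : ℕ) := by
            obtain ⟨i, -, hi⟩ := Finset.mem_biUnion.1 hkG
            exact_mod_cast (hJN i _ hi).trans (hq (hB k hkF)).le
          have h2 : ∑ x ∈ F' with q x ∈ Finset.univ.biUnion J, b' x ≤
              ∑ i, ∑ x ∈ F' with q x ∈ J i, b' x := by
            simp only [Finset.sum_filter]
            rw [Finset.sum_comm]
            refine Finset.sum_le_sum fun x _ => ?_
            have hnn : ∀ i ∈ Finset.univ, 0 ≤ if q x ∈ J i then b' x else 0 := fun i _ => by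
              split_ifs
              exacts [hb0' x, le_rfl]
            split_ifs with hx
            · obtain ⟨i, hi, hxi⟩ := Finset.mem_biUnion.1 hx
              exact (if_pos hxi).symm.le.trans (Finset.single_le_sum hnn hi)
            · exact Finset.sum_nonneg hnn
          refine h2.trans ((Finset.sum_le_sum fun i _ => hG' m (by omega) (J i) (hJ i)).trans ?_)
          rw [Finset.sum_const, Finset.card_univ, Fintype.card_fin, nsmul_eq_mul]
          have hB0 : (0 : ℝ) < (q B : ℕ) := by exact_mod_cast (q B).pos
          have hN' : (N : ℝ) ≤ (q B : ℕ) := by exact_mod_cast hN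
          rw [mul_one_div, div_le_div_iff₀ (by positivity) hr]
          nlinarith
      · push Not at hint
        rw [Finset.filter_eq_empty_iff.2 (fun k hk => hint k hk), Finset.sum_empty, zero_add]
        have h1 : ∑ k ∈ F' with q k ∈ G, b' k ≤ 1 := hsum' ▸
          Finset.sum_le_sum_of_subset_of_nonneg (Finset.filter_subset _ _) fun k _ _ => hb0' k
        have : (0 : ℝ) ≤ (t + 1 : ℕ) / r := by positivity
        linarith

/-- Repeated averages along two interlaced sequences `p ≤ q`: a probability `b` whose support has
`p`-image in `S_n`, but for which the sets in `S_m`, `m < n`, have small measure along `q`. -/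
theorem exists_schreier_average {p q : ℕ → ℕ+} (hp : StrictMono p) (hq : StrictMono q) (n : ℕ)
    (ε : ℝ) (K : ℕ) (hε : 0 < ε) : ∃ (F : Finset ℕ) (b : ℕ → ℝ), (∀ k ∈ F, K ≤ k) ∧
      (∀ k, 0 ≤ b k) ∧ (∀ k ∉ F, b k = 0) ∧ ∑ k ∈ F, b k = 1 ∧ F.image p ∈ schreier n ∧
      ∀ m < n, ∀ G ∈ schreier m, ∑ k ∈ F with q k ∈ G, b k ≤ ε := by
  induction n generalizing ε K with
  | zero =>
    refine ⟨{K}, Pi.single K 1, by simp, fun k => ?_, fun k hk => ?_, by simp, ?_, by simp⟩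
    · by_cases h : k = K
      · subst h; simp
      · simp [h]
    · rw [Pi.single_apply, if_neg (by simpa using hk)]
    · exact Or.inr ⟨p K, by simp⟩
  | succ n ih =>
    -- Averaging r successive S_n-averages bounds the mass by (1 + r/r)/r = 2/r < ε. Starting at
    -- max(K, r) puts the p-image in [r, ∞), as S_{n+1} requires of r pieces.
    obtain ⟨r, hr⟩ := exists_nat_gt (2 / ε)
    have hr0 : (0 : ℝ) < r := (by positivity : (0 : ℝ) < 2 / ε).trans hr
    have hrN : 0 < r := by exact_mod_cast hr0
    obtain ⟨F, b, hK, hb0, hbF, hsum, ⟨H, hHn, hHb, hHe, hHF⟩, hG⟩ :=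
      exists_sum_averages hp hq n ih r hr0 (max K r) r
    refine ⟨F, fun k => b k / r, fun k hk => (le_max_left _ _).trans (hK k hk),
      fun k => div_nonneg (hb0 k) hr0.le, fun k hk => by simp only [hbF k hk, zero_div], ?_, ?_, ?_⟩
    · rw [← Finset.sum_div, hsum, div_self hr0.ne']
    · have hun : F.image p = Finset.univ.biUnion fun i : Fin r => H i := by
        rw [hHF]
        ext a
        simp only [Finset.mem_biUnion, Finset.mem_range, Finset.mem_univ, true_and]
        exact ⟨fun ⟨i, hi, ha⟩ => ⟨⟨i, hi⟩, ha⟩, fun ⟨i, ha⟩ => ⟨i, i.2, ha⟩⟩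
      refine ⟨⟨r, hrN⟩, fun i => H i, fun i => hHn i, fun i a ha => ?_,
        fun i j hij => hHb i j hij, hun⟩
      have : a ∈ F.image p := by
        rw [hun]
        exact Finset.mem_biUnion.2 ⟨i, Finset.mem_univ _, ha⟩
      obtain ⟨k, hk, rfl⟩ := Finset.mem_image.1 this
      have hpid : ∀ k, k ≤ (p k : ℕ) := fun k =>
        StrictMono.le_apply (f := fun k => (p k : ℕ)) (fun i j hij => hp hij)
      exact ((le_max_right _ _).trans (hK k hk)).trans (hpid k)
    · intro m hm G hGm
      rw [← Finset.sum_div, div_le_iff₀ hr0]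
      have := hG m hm G hGm
      rw [div_self hr0.ne'] at this
      rw [div_lt_iff₀ hε] at hr
      linarith

/-! ### Lower estimates for admissible families -/

theorem mul_sum_le_iterNorm {θ : ℕ+ → ℝ} (hθ : ∀ n, 0 < θ n ∧ θ n < 1) {P : FamilyCondition}
    (hP : ∀ n k E, P n k E → ∀ i j, i ≠ j → Disjoint (E i) (E j)) (m : ℕ) {n : ℕ+} {k : ℕ}
    {E : Fin k → Finset ℕ+} (hE : P n k E) (x : C00) :
    θ n * ∑ i, iterNorm θ P m (restr (E i) x) ≤ iterNorm θ P (m + 1) x := by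
  rw [iterNorm]
  refine le_max_of_le_right (le_csSup ?_ ⟨n, k, E, hE, rfl⟩)
  refine ⟨∑ i ∈ x.support, |x i|, ?_⟩
  have hN := iterNorm_isNorm θ hθ P hP m
  rintro _ ⟨n, k, E, hE, rfl⟩
  exact (mul_le_of_le_one_left (Finset.sum_nonneg fun i _ => hN.nonneg _) (hθ n).2.le).trans
    (hN.sum_restr_le E (hP n k E hE) x)

/-- The lower estimate `c θ_n ∑ N (E_i x) ≤ N x` for `S_n`-admissible families. -/
def HasLowerEstimate (N : C00 → ℝ) (c : ℝ) (θ : ℕ+ → ℝ) : Prop :=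
  ∀ (n : ℕ+) (k : ℕ) (E : Fin k → Finset ℕ+), IsAdmissible n E → ∀ x,
    c * θ n * ∑ i, N (restr (E i) x) ≤ N x

/-- One step of the recursion costs only a shift of the index: θ_n ∑ ‖E_i x‖_m ≤ ‖x‖_{m+1}, and
α_{m+1} ≥ l α_m. So c is the lower bound l of the weight ratios, independent of n. -/
theorem weightedSum_hasLowerEstimate {θ : ℕ+ → ℝ} (hθ : ∀ n, 0 < θ n ∧ θ n < 1)
    {P : FamilyCondition} (hP : ∀ n k E, P n k E → ∀ i j, i ≠ j → Disjoint (E i) (E j))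
    (hadm : ∀ (n : ℕ+) (k : ℕ) (E : Fin k → Finset ℕ+), IsAdmissible n E → P n k E)
    {α : ℕ+ → ℝ} (hα : IsWeight α) :
    ∃ c > 0, HasLowerEstimate (weightedSum α hα (fun n => iterNorm θ P n)
      (fun n => iterNorm_isNorm θ hθ P hP n)).toFun c θ := by
  obtain ⟨l, u, hl, hu, h⟩ := hα.ratio
  refine ⟨l, hl, fun n k E hE x => ?_⟩
  have hN := fun m => iterNorm_isNorm θ hθ P hP m
  have hs : ∀ x, Summable fun m : ℕ+ => α m * iterNorm θ P m x := fun x =>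
    hα.summable (fun m => (hN m).nonneg x) (fun m => (hN m).le_l1 x)
  change l * θ n * ∑ i, ∑' m : ℕ+, α m * iterNorm θ P m (restr (E i) x) ≤
    ∑' m : ℕ+, α m * iterNorm θ P m x
  have hinj : Function.Injective fun m : ℕ+ => m + 1 := add_left_injective 1
  rw [← Summable.tsum_finsetSum (fun i _ => hs _), ← tsum_mul_left]
  -- Only the terms with index m + 1 are kept on the right; the first one is dropped.
  refine le_trans ?_ (tsum_comp_le_tsum_of_inj (hs x)
    (fun m => mul_nonneg (hα.mem m).1.le ((hN m).nonneg x)) hinj)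
  refine Summable.tsum_le_tsum (fun m => ?_)
    ((summable_sum fun i _ => hs (restr (E i) x)).mul_left _) ((hs x).comp_injective hinj)
  have h1 := (le_div_iff₀ (hα.mem m).1).1 (h m).1
  have h2 := mul_sum_le_iterNorm hθ hP m (hadm n k E hE) x
  have h3 : 0 ≤ θ n * ∑ i, iterNorm θ P m (restr (E i) x) :=
    mul_nonneg (hθ n).1.le (Finset.sum_nonneg fun i _ => (hN m).nonneg _)
  have h4 := mul_le_mul h1 h2 h3 (hα.mem (m + 1)).1.le
  simp only [Function.comp_apply, PNat.add_coe, PNat.one_coe]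
  refine le_trans (le_of_eq ?_) h4
  rw [← Finset.mul_sum]
  ring

theorem IsAdmissible.isAllowable {n k : ℕ} {E : Fin k → Finset ℕ+} (h : IsAdmissible n E) :
    IsAllowable n E := ⟨h.disjoint, h.2⟩

theorem IsAdmissible.condW (s n : ℕ+) {k : ℕ} {E : Fin k → Finset ℕ+} (h : IsAdmissible n E) :
    condW s n k E := by
  rcases le_or_gt n s with hn | hn
  · exact Or.inl ⟨hn, h.isAllowable⟩
  · exact Or.inr ⟨PNat.add_one_le_iff.2 hn, h⟩

theorem restr_sq (E : Finset ℕ+) (x : C00) : restr E (sq x) = sq (restr E x) := by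
  ext i
  simp only [restr_apply, sq_apply]
  split_ifs <;> simp

theorem convexification_sq (N : LatticeNorm) (x : C00) :
    N.convexification.toFun x ^ 2 = N.toFun (sq x) := Real.sq_sqrt (N.isNorm.nonneg _)

/-- Squaring coordinates commutes with restriction, so this is the estimate for N at x². -/
theorem HasLowerEstimate.convexification {N : LatticeNorm} {c : ℝ} {θ : ℕ+ → ℝ}
    (h : HasLowerEstimate N.toFun c θ) :
    HasLowerEstimate (fun x => N.convexification.toFun x ^ 2) c θ := by
  intro n k E hE x
  have := h n k E hE (sq x)
  simpa only [convexification_sq, restr_sq] using this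

/-- The lower estimate for the intervals `[p_k, p_{k+1})`, `k ∈ F`. -/
theorem HasLowerEstimate.sum_Ico_le {N : C00 → ℝ} {c : ℝ} {θ : ℕ+ → ℝ}
    (h : HasLowerEstimate N c θ) {p : ℕ → ℕ+} (hp : StrictMono p) {n : ℕ+} {F : Finset ℕ}
    (hF : F.image p ∈ schreier n) (x : C00) :
    c * θ n * ∑ k ∈ F, N (restr (Finset.Ico (p k) (p (k + 1))) x) ≤ N x := by
  set e := F.orderEmbOfFin rfl with he
  have hne : ∀ k, (Finset.Ico (p k) (p (k + 1))).Nonempty := fun k =>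
    Finset.nonempty_Ico.2 (hp k.lt_succ_self)
  have hmin : ∀ k, (Finset.Ico (p k) (p (k + 1))).min' (hne k) = p k := fun k =>
    le_antisymm (Finset.min'_le _ _ (Finset.left_mem_Ico.2 (hp k.lt_succ_self)))
      (Finset.le_min' _ _ _ fun a ha => (Finset.mem_Ico.1 ha).1)
  have himg : Finset.univ.image e = F := by
    ext a
    rw [← Finset.mem_coe, Finset.coe_image, Finset.coe_univ, Set.image_univ, he,
      Finset.range_orderEmbOfFin, Finset.mem_coe]
  -- The minima of these intervals are the p_k, so the S_n condition is the hypothesis on the image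
  -- of F.
  have hadm : IsAdmissible n fun i => Finset.Ico (p (e i)) (p (e i + 1)) := by
    refine ⟨fun i j hij a ha b hb => ?_, fun i => hne _, ?_⟩
    · exact (Finset.mem_Ico.1 ha).2.trans_le ((hp.monotone
        (Nat.succ_le_of_lt (e.strictMono hij))).trans (Finset.mem_Ico.1 hb).1)
    · simp only [hmin]
      rw [← himg, Finset.image_image] at hF
      exact hF
  refine le_trans (le_of_eq ?_) (h n _ _ hadm x)
  congr 1
  conv_lhs => rw [← himg]
  rw [Finset.sum_image fun i _ j _ hij => e.injective hij]

/-! ### Operators on `c₀₀` -/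

/-- The finite linear combination `∑ a_i u_i`. -/
noncomputable abbrev comb (u : ℕ+ → C00) (a : C00) : C00 := a.sum fun i t => t • u i

/-- The coordinates of the images of the unit vectors tend to `0`, when the operator is bounded
for a norm that is dominated by the norm of `ℓ_2`. -/
theorem tendsto_coord {M E : C00 → ℝ} (hM : IsLatticeNorm M)
    (hE : ∀ a : C00, E a ^ 2 ≤ ∑ i ∈ a.support, a i ^ 2) {u : ℕ+ → C00} {K : ℝ}
    (hu : ∀ a, M (comb u a) ≤ K * E a) (j : ℕ+) :
    Tendsto (fun i => u i j) atTop (𝓝 0) := by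
  have hbound : ∀ A : Finset ℕ+, ∑ i ∈ A, u i j ^ 2 ≤ K ^ 2 := by
    intro A
    -- Testing on a_i = u_i(j) makes the j-th coordinate of the combination equal to S = ∑ u_i(j)².
    -- Hence S ≤ K E(a) ≤ K √S, so S ≤ K² for every finite A.
    set a : C00 := Finsupp.indicator A fun i _ => u i j with ha
    have haA : a.support ⊆ A := Finsupp.support_indicator_subset _ _
    have hai : ∀ i ∈ A, a i = u i j := fun i hi => by
      rw [ha, Finsupp.indicator_of_mem hi]
    have h1 : comb u a j = ∑ i ∈ A, u i j ^ 2 := by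
      rw [comb, Finsupp.sum_of_support_subset _ haA _ (by simp), Finsupp.finsetSum_apply]
      refine Finset.sum_congr rfl fun i hi => ?_
      rw [Finsupp.smul_apply, hai i hi, smul_eq_mul, pow_two]
    have h2 : ∑ i ∈ a.support, a i ^ 2 ≤ ∑ i ∈ A, u i j ^ 2 := by
      rw [Finset.sum_congr rfl fun i hi => by rw [hai i (haA hi)]]
      exact Finset.sum_le_sum_of_subset_of_nonneg haA fun _ _ _ => sq_nonneg _
    set S := ∑ i ∈ A, u i j ^ 2 with hS
    have hS0 : 0 ≤ S := Finset.sum_nonneg fun _ _ => sq_nonneg _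
    have h3 : S ≤ K * E a := by
      have := (hM.abs_le (comb u a) j).trans (hu a)
      rwa [h1, abs_of_nonneg hS0] at this
    have h4 : S ^ 2 ≤ K ^ 2 * S := by
      calc S ^ 2 ≤ (K * E a) ^ 2 := pow_le_pow_left₀ hS0 h3 2
        _ = K ^ 2 * E a ^ 2 := mul_pow _ _ _
        _ ≤ K ^ 2 * S := mul_le_mul_of_nonneg_left ((hE a).trans h2) (sq_nonneg K)
    rcases hS0.eq_or_lt with h | h
    · rw [← h]; exact sq_nonneg K
    · rw [pow_two] at h4
      exact le_of_mul_le_mul_right h4 h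
  have hsum : Summable fun i => u i j ^ 2 :=
    summable_of_sum_le (fun i => sq_nonneg _) hbound
  have h := hsum.tendsto_cofinite_zero.sqrt
  have hat : (atTop : Filter ℕ+) ≤ cofinite := Filter.atTop_le_cofinite
  have h' := h.mono_left hat
  simp only [Real.sqrt_sq_eq_abs, Real.sqrt_zero] at h'
  exact (tendsto_zero_iff_abs_tendsto_zero _).2 h'

/-- Sliding hump: `p_k ≤ q_k < p_{k+1}`, and `u_{q_k}` is supported on `[p_k, p_{k+1})` up to a
small error. -/
theorem exists_sliding_hump {u : ℕ+ → C00} (hu : ∀ j, Tendsto (fun i => u i j) atTop (𝓝 0))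
    {η : ℕ → ℝ} (hη : ∀ k, 0 < η k) :
    ∃ p q : ℕ → ℕ+, (∀ k, p k ≤ q k) ∧ (∀ k, q k < p (k + 1)) ∧
      (∀ k, ∀ i ∈ (u (q k)).support, i < p (k + 1)) ∧
      ∀ k, ∑ j ∈ Finset.Iio (p k), |u (q k) j| ≤ η k := by
  have hstep : ∀ (k : ℕ) (a : ℕ+), ∃ i, a ≤ i ∧ ∑ j ∈ Finset.Iio a, |u i j| ≤ η k := by
    intro k a
    have h1 : Tendsto (fun i => ∑ j ∈ Finset.Iio a, |u i j|) atTop (𝓝 0) := by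
      have := tendsto_finsetSum (Finset.Iio a) fun j _ => (hu j).abs
      simpa using this
    obtain ⟨i, h2, h3⟩ := ((eventually_ge_atTop a).and (h1.eventually_lt_const (hη k))).exists
    exact ⟨i, h2, h3.le⟩
  choose f hf1 hf2 using hstep
  have hnext : ∀ i, ∃ b : ℕ+, i < b ∧ ∀ j ∈ (u i).support, j < b := by
    intro i
    refine ⟨(insert i (u i).support).sup' (Finset.insert_nonempty _ _) id + 1, ?_, fun j hj => ?_⟩
    · exact PNat.lt_add_one_iff.2 (Finset.le_sup' id (Finset.mem_insert_self _ _))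
    · exact PNat.lt_add_one_iff.2 (Finset.le_sup' id (Finset.mem_insert_of_mem hj))
  choose g hg1 hg2 using hnext
  let p : ℕ → ℕ+ := fun k => Nat.rec 1 (fun k a => g (f k a)) k
  exact ⟨p, fun k => f k (p k), fun k => hf1 k (p k), fun k => hg1 _, fun k => hg2 _,
    fun k => hf2 k (p k)⟩

theorem IsLatticeNorm.sum_smul_le {M : C00 → ℝ} (hM : IsLatticeNorm M) {ι : Type*} (F : Finset ι)
    (a : ι → ℝ) (v : ι → C00) : M (∑ k ∈ F, a k • v k) ≤ ∑ k ∈ F, |a k| * M (v k) := by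
  refine (Finset.le_sum_of_subadditive M hM.zero.le hM.add_le F fun k => a k • v k).trans_eq ?_
  simp only [hM.smul]

/-- If the part of `v` outside `[a, b)` is small in `ℓ_1`, then so is its norm. -/
theorem IsLatticeNorm.sub_restr_le {M : C00 → ℝ} (hM : IsLatticeNorm M) {v : C00} {a b : ℕ+}
    (hv : ∀ i ∈ v.support, i < b) :
    M (v - restr (Finset.Ico a b) v) ≤ ∑ j ∈ Finset.Iio a, |v j| := by
  have happ : ∀ i, (v - restr (Finset.Ico a b) v) i = if i ∈ Finset.Iio a then v i else 0 := by
    intro i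
    rw [Finsupp.sub_apply, restr_apply]
    by_cases h1 : i < a
    · simp [h1]
    · by_cases h2 : v i = 0
      · simp [h2]
      · simp [not_lt.1 h1, hv i (Finsupp.mem_support_iff.2 h2)]
  refine (hM.le_l1 _).trans ?_
  refine (Finset.sum_le_sum_of_subset_of_nonneg (t := Finset.Iio a) (fun i hi => ?_)
    fun _ _ _ => abs_nonneg _).trans (Finset.sum_le_sum fun i hi => ?_)
  · rw [Finsupp.mem_support_iff, happ] at hi
    by_contra h
    exact hi (if_neg h)
  · rw [happ, if_pos hi]

theorem restr_sum_blocks {p : ℕ → ℕ+} (hp : StrictMono p) (F : Finset ℕ) (a : ℕ → ℝ)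
    (v : ℕ → C00) {k : ℕ} (hk : k ∈ F) :
    restr (Finset.Ico (p k) (p (k + 1)))
      (∑ l ∈ F, a l • restr (Finset.Ico (p l) (p (l + 1))) (v l)) =
      a k • restr (Finset.Ico (p k) (p (k + 1))) (v k) := by
  ext i
  rw [restr_apply, Finsupp.finsetSum_apply, Finsupp.smul_apply, restr_apply]
  split_ifs with hi
  · rw [Finset.sum_eq_single k]
    · rw [Finsupp.smul_apply, restr_apply, if_pos hi]
    · intro l _ hl
      rw [Finsupp.smul_apply, restr_apply, if_neg, smul_zero]
      intro hi'
      rw [Finset.mem_Ico] at hi hi'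
      rcases lt_or_gt_of_ne hl with h | h
      · exact absurd (hi'.2.trans_le ((hp.monotone h).trans hi.1)) (lt_irrefl _)
      · exact absurd (hi.2.trans_le ((hp.monotone h).trans hi'.1)) (lt_irrefl _)
    · exact fun h => absurd hk h
  · rw [smul_zero]

/-- The vector `∑ √b_k e_{q_k}`. -/
theorem exists_sqrt_comb {q : ℕ → ℕ+} (hq : StrictMono q) {F : Finset ℕ} {b : ℕ → ℝ}
    (hb0 : ∀ k, 0 ≤ b k) (hbF : ∀ k ∉ F, b k = 0) :
    ∃ a : C00, (∀ k, a (q k) = √(b k)) ∧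
      (∀ G : Finset ℕ+, ∑ i ∈ G, a i ^ 2 = ∑ k ∈ F with q k ∈ G, b k) ∧
      ∀ u : ℕ+ → C00, comb u a = ∑ k ∈ F, √(b k) • u (q k) := by
  have hF : ∀ k, √(b k) ≠ 0 → k ∈ F := fun k hk => by
    by_contra h
    exact hk (by rw [hbF k h, Real.sqrt_zero])
  set a : C00 := Finsupp.mapDomain q (Finsupp.onFinset F (fun k => √(b k)) hF) with ha
  have hak : ∀ k, a (q k) = √(b k) := fun k => by
    rw [ha, Finsupp.mapDomain_apply hq.injective, Finsupp.onFinset_apply]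
  refine ⟨a, hak, fun G => ?_, fun u => ?_⟩
  · have hsq : ∀ i, a i ^ 2 = ∑ k ∈ F, if q k = i then b k else 0 := by
      intro i
      by_cases hi : i ∈ Set.range q
      · obtain ⟨k, rfl⟩ := hi
        rw [hak, Real.sq_sqrt (hb0 k)]
        simp only [hq.injective.eq_iff, Finset.sum_ite_eq']
        split_ifs with h
        exacts [rfl, hbF k h]
      · rw [ha, Finsupp.mapDomain_of_notMem_range _ _ hi, Finset.sum_eq_zero]
        · simp
        · exact fun k _ => if_neg fun h => hi ⟨k, h⟩
    rw [Finset.sum_filter, Finset.sum_congr rfl fun i _ => hsq i, Finset.sum_comm]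
    exact Finset.sum_congr rfl fun k _ => Finset.sum_ite_eq G (q k) _
  · rw [comb, ha, Finsupp.sum_mapDomain_index (by simp) (fun _ _ _ => add_smul _ _ _),
      Finsupp.onFinset_sum _ (by simp)]

/-- If an operator on `c₀₀` is bounded from Edgington's norm to a norm with a 2-convex lower
estimate with constants `θ_n`, and bounded below on the unit vectors, then `θ` decays
geometrically. -/
theorem exists_le_geometric {M : C00 → ℝ} (hM : IsLatticeNorm M) {c : ℝ} (hc : 0 < c)
    {θ : ℕ+ → ℝ} (hlow : HasLowerEstimate (fun x => M x ^ 2) c θ) (hθ : ∀ n, 0 < θ n)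
    {β : ℕ+ → ℝ} (hβ : IsWeight β) {u : ℕ+ → C00} {K δ : ℝ} (hδ : 0 < δ)
    (hu : ∀ a, M (comb u a) ≤ K * (normE β hβ).toFun a) (huδ : ∀ i, δ ≤ M (u i)) :
    ∃ C w : ℝ, 0 < w ∧ w < 1 ∧ ∀ n : ℕ+, θ n ≤ C * w ^ (n : ℕ) := by
  obtain ⟨C, w, hw0, hw1, hC⟩ := exists_normE_sq_le β hβ
  obtain ⟨p, q, hpq, hqp, hsupp, hη⟩ := exists_sliding_hump
    -- Each error is at most δ/2, so the blocks z_k keep norm at least δ/2; together the errors sum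
    -- to at most δ.
    (tendsto_coord hM (normE_sq_le_l2 β hβ) hu) (η := fun k => δ / 2 * (1 / 2) ^ k)
    fun k => by positivity
  have hp : StrictMono p := strictMono_nat_of_lt_succ fun k => (hpq k).trans_lt (hqp k)
  have hq : StrictMono q := strictMono_nat_of_lt_succ fun k => (hqp k).trans_le (hpq (k + 1))
  set z : ℕ → C00 := fun k => restr (Finset.Ico (p k) (p (k + 1))) (u (q k)) with hz
  have huz : ∀ k, M (u (q k) - z k) ≤ δ / 2 * (1 / 2) ^ k := fun k =>
    (hM.sub_restr_le (hsupp k)).trans (hη k)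
  have hzδ : ∀ k, δ / 2 ≤ M (z k) := by
    intro k
    have h1 := hM.add_le (u (q k) - z k) (z k)
    rw [sub_add_cancel] at h1
    have h2 : (1 / 2 : ℝ) ^ k ≤ 1 := pow_le_one₀ (by norm_num) (by norm_num)
    nlinarith [huz k, huδ (q k)]
  refine ⟨(K + δ) ^ 2 * (1 + C) / (c * (δ / 2) ^ 2), w, hw0, hw1, fun n => ?_⟩
  -- Taking ε = w^n matches the tail term C w^n.
  obtain ⟨F, b, -, hb0, hbF, hsum, hFn, hG⟩ :=
    exists_schreier_average hp hq n (w ^ (n : ℕ)) 0 (by positivity)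
  obtain ⟨a, hak, haG, hcomb⟩ := exists_sqrt_comb hq hb0 hbF
  have hEn := (normE β hβ).isNorm
  set e := (normE β hβ).toFun a with he
  have he0 : 0 ≤ e := hEn.nonneg a
  have hEa : e ^ 2 ≤ w ^ (n : ℕ) + C * w ^ (n : ℕ) := by
    refine hC n _ a (by positivity) ?_ fun m hm G hGm => ?_
    · rw [haG, ← hsum]
      exact Finset.sum_le_sum_of_subset_of_nonneg (Finset.filter_subset _ _) fun k _ _ => hb0 k
    · rw [haG]
      exact hG m hm G hGm
  set y : C00 := ∑ k ∈ F, √(b k) • z k with hy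
  have hMy : M y ≤ (K + δ) * e := by
    have h1 : y = comb u a + ∑ k ∈ F, (-√(b k)) • (u (q k) - z k) := by
      rw [hcomb, ← Finset.sum_add_distrib]
      refine Finset.sum_congr rfl fun k _ => ?_
      module
    -- The coefficients √b_k are coordinates of a, hence at most e. This makes the truncation error
    -- proportional to e and not merely bounded.
    have h2 : ∑ k ∈ F, |-√(b k)| * M (u (q k) - z k) ≤ ∑ k ∈ F, e * (δ / 2 * (1 / 2) ^ k) := by
      refine Finset.sum_le_sum fun k _ => mul_le_mul ?_ (huz k) (hM.nonneg _) he0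
      rw [abs_neg, ← hak]
      exact hEn.abs_le a (q k)
    have h3 : ∑ k ∈ F, e * (δ / 2 * (1 / 2) ^ k) ≤ δ * e := by
      rw [← Finset.mul_sum, ← Finset.mul_sum]
      have := summable_geometric_two.sum_le_tsum F (fun k _ => by positivity)
      rw [tsum_geometric_two] at this
      nlinarith [mul_nonneg he0 hδ.le]
    have h4 := hM.add_le (comb u a) (∑ k ∈ F, (-√(b k)) • (u (q k) - z k))
    have h5 := hM.sum_smul_le F (fun k => -√(b k)) fun k => u (q k) - z k
    rw [← h1] at h4
    linarith [hu a]
  -- Restricting y to the k-th interval recovers √b_k z_k, of squared norm at least b_k (δ/2)², and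
  -- ∑ b_k = 1.
  have hlow' : c * θ n * (δ / 2) ^ 2 ≤ M y ^ 2 := by
    refine le_trans ?_ (hlow.sum_Ico_le hp hFn y)
    refine mul_le_mul_of_nonneg_left ?_ (mul_nonneg hc.le (hθ n).le)
    rw [← one_mul ((δ / 2) ^ 2), ← hsum, Finset.sum_mul]
    refine Finset.sum_le_sum fun k hk => ?_
    rw [hy, hz, restr_sum_blocks hp F _ (fun k => u (q k)) hk, hM.smul, mul_pow, sq_abs,
      Real.sq_sqrt (hb0 k)]
    exact mul_le_mul_of_nonneg_left (pow_le_pow_left₀ (by positivity) (hzδ k) 2) (hb0 k)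
  have h1 : M y ^ 2 ≤ (K + δ) ^ 2 * (w ^ (n : ℕ) + C * w ^ (n : ℕ)) := by
    refine (pow_le_pow_left₀ (hM.nonneg y) hMy 2).trans ?_
    rw [mul_pow]
    exact mul_le_mul_of_nonneg_left hEa (sq_nonneg _)
  rw [div_mul_eq_mul_div, le_div_iff₀ (by positivity)]
  linarith

/-- Taking n-th roots, C^{1/n} w → w < 1, whereas θ_n^{1/n} → 1. -/
theorem not_le_geometric {θ : ℕ+ → ℝ} (hθ : ∀ n, 0 < θ n)
    (hθ1 : Tendsto (fun n : ℕ+ => θ n ^ (1 / (n : ℝ))) atTop (𝓝 1)) {C w : ℝ} (hw0 : 0 < w)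
    (hw1 : w < 1) (h : ∀ n : ℕ+, θ n ≤ C * w ^ (n : ℕ)) : False := by
  have hC : 0 < C := by
    have := (hθ 1).trans_le (h 1)
    exact pos_of_mul_pos_left this (by positivity)
  have hcoe : Tendsto (fun n : ℕ+ => (n : ℕ)) atTop atTop :=
    tendsto_atTop_atTop.2 fun b => ⟨b.succPNat, fun n hn =>
      (Nat.le_succ b).trans (by exact_mod_cast hn)⟩
  have hinv : Tendsto (fun n : ℕ+ => 1 / ((n : ℕ) : ℝ)) atTop (𝓝 0) :=
    tendsto_one_div_atTop_nhds_zero_nat.comp hcoe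
  have hlim : Tendsto (fun n : ℕ+ => C ^ (1 / ((n : ℕ) : ℝ)) * w) atTop (𝓝 (1 * w)) := by
    refine Tendsto.mul_const w ?_
    have := (tendsto_const_nhds (x := C)).rpow hinv (Or.inl hC.ne')
    rwa [Real.rpow_zero] at this
  refine absurd (le_of_tendsto_of_tendsto' hθ1 hlim fun n => ?_) (by simpa using hw1)
  have hn : ((n : ℕ) : ℝ) ≠ 0 := by exact_mod_cast n.ne_zero
  refine (Real.rpow_le_rpow (hθ n).le (h n) (by positivity)).trans_eq ?_
  rw [Real.mul_rpow hC.le (by positivity), ← Real.rpow_natCast w, ← Real.rpow_mul hw0.le,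
    mul_one_div_cancel hn, Real.rpow_one]

/-! ### Passage to the completions -/

/-- The embedding of `c₀₀` into its completion. -/
noncomputable def LatticeNorm.ofC00 (N : LatticeNorm) : C00 →ₗ[ℝ] N.Space where
  toFun x := ((show N.Normed from x : N.Normed) : N.Space)
  map_add' x y := UniformSpace.Completion.coe_add (α := N.Normed) x y
  map_smul' c x := UniformSpace.Completion.coe_smul (M := ℝ) (X := N.Normed) c x

theorem LatticeNorm.norm_ofC00 (N : LatticeNorm) (x : C00) : ‖N.ofC00 x‖ = N.toFun x :=
  UniformSpace.Completion.norm_coe (E := N.Normed) x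

theorem LatticeNorm.exists_near (N : LatticeNorm) (y : N.Space) {ε : ℝ} (hε : 0 < ε) :
    ∃ x : C00, ‖N.ofC00 x - y‖ < ε := by
  obtain ⟨x, hx⟩ := (UniformSpace.Completion.denseRange_coe (α := N.Normed)).exists_dist_lt y hε
  refine ⟨x, ?_⟩
  rw [dist_comm, dist_eq_norm] at hx
  exact hx

/-- An isomorphism onto the completion of `(c₀₀, M)` gives, by perturbation, an operator on `c₀₀`
that is bounded, and bounded below on the unit vectors. -/
theorem exists_operator {E M : LatticeNorm} (f : M.Space ≃L[ℝ] E.Space) :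
    ∃ (u : ℕ+ → C00) (K δ : ℝ), 0 < δ ∧ (∀ a, M.toFun (comb u a) ≤ K * E.toFun a) ∧
      ∀ i, δ ≤ M.toFun (u i) := by
  set T : E.Space →L[ℝ] M.Space := f.symm.toContinuousLinearMap with hT
  set S : M.Space →L[ℝ] E.Space := f.toContinuousLinearMap with hS
  have hST : ∀ x, S (T x) = x := fun x => f.apply_symm_apply x
  set e : ℕ+ → E.Space := fun i => E.ofC00 (Finsupp.single i 1) with he
  -- From 1 = ‖S T e_i‖ ≤ ‖S‖ ‖T e_i‖; the added 1 makes the denominator visibly positive.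
  have hlow : ∀ i, 1 / (‖S‖ + 1) ≤ ‖T (e i)‖ := by
    intro i
    have h1 := S.le_opNorm (T (e i))
    rw [hST, he, E.norm_ofC00, E.isNorm.single] at h1
    rw [div_le_iff₀ (by positivity)]
    nlinarith [norm_nonneg (T (e i))]
  set δ := 1 / (‖S‖ + 1) / 2 with hδ
  have hδ0 : 0 < δ := by positivity
  -- The lower bound for ‖T e_i‖ is 2δ, so an error of at most δ leaves δ. The geometric factor
  -- makes the total perturbation at most 2δ times the norm of a, whose coordinates that norm
  -- dominates.
  choose u hu using fun i : ℕ+ => M.exists_near (T (e i))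
    (ε := δ * (1 / 2) ^ (i : ℕ)) (by positivity)
  refine ⟨u, ‖T‖ + δ * 2, δ, hδ0, fun a => ?_, fun i => ?_⟩
  · have h1 : M.ofC00 (comb u a) =
        T (E.ofC00 a) + ∑ i ∈ a.support, a i • (M.ofC00 (u i) - T (e i)) := by
      have h2 : T (E.ofC00 a) = ∑ i ∈ a.support, a i • T (e i) := by
        conv_lhs => rw [← Finsupp.sum_single a]
        rw [Finsupp.sum, map_sum, map_sum]
        refine Finset.sum_congr rfl fun i _ => ?_
        rw [he, ← map_smul, ← map_smul, Finsupp.smul_single, smul_eq_mul, mul_one]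
      rw [h2, ← Finset.sum_add_distrib, comb, Finsupp.sum, map_sum]
      refine Finset.sum_congr rfl fun i _ => ?_
      rw [map_smul]
      module
    have h3 : ∑ i ∈ a.support, ‖a i • (M.ofC00 (u i) - T (e i))‖ ≤
        ∑ i ∈ a.support, E.toFun a * (δ * (1 / 2) ^ (i : ℕ)) := by
      refine Finset.sum_le_sum fun i _ => ?_
      rw [norm_smul]
      exact mul_le_mul (E.isNorm.abs_le a i) (hu i).le (norm_nonneg _) (E.isNorm.nonneg a)
    have h4 : ∑ i ∈ a.support, E.toFun a * (δ * (1 / 2) ^ (i : ℕ)) ≤ E.toFun a * (δ * 2) := by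
      rw [← Finset.mul_sum, ← Finset.mul_sum]
      refine mul_le_mul_of_nonneg_left (mul_le_mul_of_nonneg_left ?_ hδ0.le) (E.isNorm.nonneg a)
      have h5 := summable_geometric_two.sum_le_tsum (a.support.image fun i : ℕ+ => (i : ℕ))
        (fun k _ => by positivity)
      rwa [tsum_geometric_two, Finset.sum_image fun i _ j _ hij => PNat.coe_injective hij] at h5
    have h6 := T.le_opNorm (E.ofC00 a)
    rw [E.norm_ofC00] at h6
    rw [← M.norm_ofC00, h1]
    refine (norm_add_le _ _).trans ?_
    linarith [norm_sum_le a.support fun i => a i • (M.ofC00 (u i) - T (e i))]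
  · have h1 := norm_sub_norm_le (T (e i)) (M.ofC00 (u i))
    rw [norm_sub_rev, M.norm_ofC00] at h1
    have h2 : (1 / 2 : ℝ) ^ (i : ℕ) ≤ 1 := pow_le_one₀ (by norm_num) (by norm_num)
    have h3 : 1 / (‖S‖ + 1) = δ + δ := by rw [hδ]; ring
    nlinarith [hu i, hlow i]

/-! ### Non-isomorphism from the lower estimate -/

theorem isEmpty_equiv_normE {θ : ℕ+ → ℝ} (hθ : ∀ n, 0 < θ n)
    (hθ1 : Tendsto (fun n : ℕ+ => θ n ^ (1 / (n : ℝ))) atTop (𝓝 1)) {N : LatticeNorm} {c : ℝ}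
    (hc : 0 < c) (hN : HasLowerEstimate N.toFun c θ) {β : ℕ+ → ℝ} (hβ : IsWeight β) :
    IsEmpty (N.convexification.Space ≃L[ℝ] (normE β hβ).Space) := by
  refine ⟨fun f => ?_⟩
  obtain ⟨u, K, δ, hδ, hu, huδ⟩ := exists_operator f
  obtain ⟨C, w, hw0, hw1, h⟩ :=
    exists_le_geometric N.convexification.isNorm hc hN.convexification hθ hβ hδ hu huδ
  exact not_le_geometric hθ hθ1 hw0 hw1 h

end WeakHilbert

theorem theorem3p6
    (θ : ℕ+ → ℝ) (hθ : ∀ n, 0 < θ n ∧ θ n < 1) (hθ0 : Tendsto θ atTop (𝓝 0))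
    (hθ1 : Tendsto (fun n : ℕ+ => θ n ^ (1 / (n : ℝ))) atTop (𝓝 1))
    (s : ℕ+)
    (α : ℕ+ → ℝ) (hα : WeakHilbert.IsWeight α)
    (β : ℕ+ → ℝ) (hβ : WeakHilbert.IsWeight β) :
    IsEmpty ((WeakHilbert.normV' θ hθ α hα).convexification.Space ≃L[ℝ]
      (WeakHilbert.normE β hβ).Space) ∧
    IsEmpty ((WeakHilbert.normW' θ hθ s α hα).convexification.Space ≃L[ℝ]
      (WeakHilbert.normE β hβ).Space) := by
  obtain ⟨c, hc, hV⟩ := WeakHilbert.weightedSum_hasLowerEstimate hθ WeakHilbert.condV_disjoint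
    (fun n k E h => h.isAllowable) hα
  obtain ⟨d, hd, hW⟩ := WeakHilbert.weightedSum_hasLowerEstimate hθ (WeakHilbert.condW_disjoint s)
    (fun n k E h => h.condW s n) hα
  exact ⟨WeakHilbert.isEmpty_equiv_normE (fun n => (hθ n).1) hθ1 hc hV hβ,
    WeakHilbert.isEmpty_equiv_normE (fun n => (hθ n).1) hθ1 hd hW hβ⟩
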